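/- Let $d\ge 1$ be an integer and let $0<\alpha<\beta<1/2$ satisfy $\Gamma:=(2\beta)^d-(2\alpha)^d>1/2$. For $\sigma>0$, $\zeta\in\mathbb R$ and $n\ge 1$, let $T_n^d$ be the $d$-dimensional lattice torus obtained from $\mathbb Z^d\cap[0,n]^d$ by identifying opposite faces, with its nearest-neighbour edges and the $\ell_\infty$ torus metric $d_\infty^T$. The modified Newman–Watts random graph $G_n=G_n(\alpha,\beta,\sigma,\zeta)$ is obtained from $T_n^d$ by adding, independently for each unordered pair of vertices $\{u,v\}$ with $\alpha n\le d_\infty^T(u,v)\le\beta n$, the edge $uv$ with probability $p_n=\sigma n^{-d}(\ln n)^{\zeta}$ (which lies in $[0,1]$ for all large $n$). Let $V_n$ be its vertex set and let $$\iota=\iota(G_n):=\min_{\emptyset\ne S\subset V_n,\ |S|\le |V_n|/2}\frac{\mathcal E(S,S^c)}{|S|}$$ be its edge isoperimetric constant, where $\mathcal E(S,S^c)$ is the number of edges of $G_n$ between $S$ and $S^c=V_n\setminus S$. (i) If $0<\zeta<1$ and $\sigma>0$, or if $\zeta=0$ and $\sigma\ge\sigma_0$ for some $\sigma_0>0$ depending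 only on $d,\alpha,\beta$, then there is a constant $C>0$ (not depending on $n$) such that $$\lim_{n\to\infty}\mathbb P\left(\iota(G_n)\ge C(\ln n)^{-1}\right)=1.$$ (ii) If $\zeta>1$ and $\sigma>0$, or if $\zeta=1$ and $\sigma\ge\sigma_0$ for some $\sigma_0>0$ depending only on $d,\alpha,\beta$, then there is a constant $C>0$ (not depending on $n$) such that $$\lim_{n\to\infty}\mathbb P\left(\iota(G_n)\ge C\right)=1.$$ -/

import Mathlib

open Filter Topology

noncomputable section

namespace ModifiedNW

/-- Vertices of the `d`-dimensional lattice torus of side `n`: the cube `{0, …, n}^d` with opposite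
faces glued together, each class being represented by its point with coordinates in
`{0, …, n - 1}`. -/
abbrev Vertex (d n : ℕ) : Type := Fin d → Fin n

/-- Distance on the cycle of length `n`: the least `|a - b + k n|` over integers `k`. -/
def cycleDist {n : ℕ} (a b : Fin n) : ℕ :=
  min (Nat.dist a b) (n - Nat.dist a b)

/-- The `ℓ^∞` metric of the torus. -/
def torusDist {d n : ℕ} (u v : Vertex d n) : ℕ :=
  Finset.univ.sup fun i => cycleDist (u i) (v i)

theorem cycleDist_comm {n : ℕ} (a b : Fin n) : cycleDist a b = cycleDist b a := by
  simp only [cycleDist, Nat.dist_comm]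

theorem torusDist_comm {d n : ℕ} (u v : Vertex d n) : torusDist u v = torusDist v u := by
  simp only [torusDist, cycleDist_comm]

/-- The nearest neighbour graph of the torus: `u` and `v` are adjacent when they differ in exactly
one coordinate, by one step along the cycle. -/
def torusGraph (d n : ℕ) : SimpleGraph (Vertex d n) where
  Adj u v := ∃ i, cycleDist (u i) (v i) = 1 ∧ ∀ j, j ≠ i → u j = v j
  symm := ⟨fun u v ⟨i, h, h'⟩ => ⟨i, by rw [cycleDist_comm]; exact h, fun j hj => (h' j hj).symm⟩⟩
  loopless := ⟨fun u ⟨i, h, _⟩ => by simp [cycleDist] at h⟩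

/-- The unordered pairs `{u, v}` with `α n ≤ d(u, v) ≤ β n`, which may carry a long edge. -/
def longPairs (d n : ℕ) (α β : ℝ) : Set (Sym2 (Vertex d n)) :=
  {e | ∃ u v, e = s(u, v) ∧ α * n ≤ torusDist u v ∧ (torusDist u v : ℝ) ≤ β * n}

/-- The long edge probability `p_n = σ n^{-d} (ln n)^ζ`, clipped to `[0, 1]` (this matters only for
the finitely many `n` for which the formula is not a probability). -/
def longEdgeProb (d n : ℕ) (σ ζ : ℝ) : unitInterval :=
  Set.projIcc 0 1 zero_le_one (σ * ((n : ℝ) ^ d)⁻¹ * Real.log n ^ ζ)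

/-- The law of the random set of long edges: every pair of `longPairs` is included independently
with probability `p_n`. -/
def longEdgeLaw (d n : ℕ) (α β σ ζ : ℝ) : MeasureTheory.Measure (Set (Sym2 (Vertex d n))) :=
  ProbabilityTheory.setBernoulli (longPairs d n α β) (longEdgeProb d n σ ζ)

/-- The graph `G_n` obtained by adding a set `E` of long edges to the torus. -/
def nwGraph (d n : ℕ) (E : Set (Sym2 (Vertex d n))) : SimpleGraph (Vertex d n) :=
  torusGraph d n ⊔ SimpleGraph.fromEdgeSet E

open scoped Classical in
/-- The edge isoperimetric constant `min |E(S, Sᶜ)| / |S|`, over the nonempty vertex sets `S` with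
at most half of the vertices. -/
def edgeIsoperimetricConst {V : Type*} [Fintype V] (G : SimpleGraph V) : ℝ :=
  ⨅ S : {S : Finset V // S.Nonempty ∧ 2 * S.card ≤ Fintype.card V},
    ((G.interedges S.1 S.1ᶜ).card : ℝ) / (S.1.card : ℝ)

/-- With high probability (that is, with probability tending to `1` as `n → ∞`) the edge
isoperimetric constant of `G_n` is at least `b n`. -/
def WhpIsoperimetricGe (d : ℕ) (α β σ ζ : ℝ) (b : ℕ → ℝ) : Prop :=
  Tendsto
    (fun n : ℕ => longEdgeLaw d n α β σ ζ {E | b n ≤ edgeIsoperimetricConst (nwGraph d n E)})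
    atTop (𝓝 1)

end ModifiedNW

end

/-! A first-moment bound over sparse cuts. Since `Γ > 1/2`, each vertex has at least `(1/2 + c) n^d`
potential long partners, so at least `c n^d |S|` long pairs leave any `S` with at most half of the
vertices (`card_longBoundary_ge`). A Chernoff bound makes the chance that at most `b |S|` of them
are present at most `exp (-(c p n^d / 2 - b) |S|)`.

This must beat the number of sets `S`. If `p n^d` is a large multiple of `ln n`, listing the
vertices of `S` costs order `|S| ln n`, which is affordable with `b = 1`. If `p n^d` is only bounded
below, take `b = C / ln n`: only sets with fewer than `b |S|` torus boundary edges matter, and such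
a set is determined by those edges, at a cost of order `b |S| ln n = C |S|`. `sum_exp_le_of_injOn`
does the counting for either encoding. -/

namespace ModifiedNW

/-! ### Tail bound and counting -/

/-- Lower tail bound for the number of elements of `A` in a Bernoulli random subset of `u ⊇ A`. -/
theorem setBernoulli_real_card_filter_le {ι : Type*} [Fintype ι] [DecidableEq ι] {u A : Finset ι}
    (hA : A ⊆ u) (p : unitInterval) (a : ℝ) :
    (ProbabilityTheory.setBernoulli (u : Set ι) p).real
      {s | ((A : Set ι) ∩ s).ncard ≤ a} ≤ Real.exp (a - p * A.card / 2) := by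
  classical
  set μ := ProbabilityTheory.setBernoulli (u : Set ι) p with hμ
  have hp0 : (0 : ℝ) ≤ p := p.2.1
  have hp1 : (p : ℝ) ≤ 1 := p.2.2
  -- Exponential Markov at parameter `-1`: on the event, `exp (a - |A ∩ t|) ≥ 1`, and this weight
  -- factors over elements.
  set w : ι → ℝ := fun i => if i ∈ A then Real.exp (-1) else 1 with hw
  set B : Finset (Finset ι) := {t ∈ u.powerset | ((A ∩ t).card : ℝ) ≤ a} with hB
  have hsub : {s : Set ι | ((A : Set ι) ∩ s).ncard ≤ a} ∩ {s | s ⊆ u} ⊆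
      ((B.image fun t : Finset ι => (t : Set ι)) : Finset (Set ι)) := by
    rintro s ⟨hs, hsu⟩
    simp only [Set.mem_ofPred_eq] at hs hsu
    simp only [Finset.coe_image, Set.mem_image, Finset.mem_coe, hB, Finset.mem_filter,
      Finset.mem_powerset]
    refine ⟨s.toFinset, ⟨by simpa using hsu, ?_⟩, by simp⟩
    rw [← Set.ncard_coe_finset]
    simpa using hs
  have h1 : μ.real {s | ((A : Set ι) ∩ s).ncard ≤ a} ≤
      ∑ t ∈ B, (p : ℝ) ^ t.card * (1 - p) ^ (u \ t).card := by
    have e1 : μ.real {s | ((A : Set ι) ∩ s).ncard ≤ a} =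
        μ.real ({s : Set ι | ((A : Set ι) ∩ s).ncard ≤ a} ∩ {s | s ⊆ u}) := by
      rw [MeasureTheory.measureReal_def, hμ,
        ProbabilityTheory.setBernoulli_apply_eq_apply_subsets]
      rfl
    rw [e1]
    refine (MeasureTheory.measureReal_mono hsub).trans ?_
    rw [← MeasureTheory.sum_measureReal_singleton, Finset.sum_image (by
      intro x _ y _ h; exact Finset.coe_injective h)]
    refine (Finset.sum_congr rfl fun t ht => ?_).le
    have htu : t ⊆ u := by
      simp only [hB, Finset.mem_filter, Finset.mem_powerset] at ht; exact ht.1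
    rw [hμ, ProbabilityTheory.setBernoulli_real_singleton p (by exact_mod_cast htu)
      u.finite_toSet, Set.ncard_coe_finset, ← Finset.coe_sdiff, Set.ncard_coe_finset]
  have h2 : ∑ t ∈ B, (p : ℝ) ^ t.card * (1 - p) ^ (u \ t).card ≤
      ∑ t ∈ u.powerset, Real.exp a * ((∏ i ∈ t, (p * w i)) * ∏ i ∈ u \ t, (1 - (p : ℝ))) := by
    refine (Finset.sum_le_sum (g := fun t => Real.exp a *
      ((∏ i ∈ t, (p * w i)) * ∏ i ∈ u \ t, (1 - (p : ℝ)))) fun t ht => ?_).trans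
      (Finset.sum_le_sum_of_subset_of_nonneg (Finset.filter_subset _ _) fun t _ _ => ?_)
    · have hta : ((A ∩ t).card : ℝ) ≤ a := (Finset.mem_filter.1 ht).2
      have hprod : ∏ i ∈ t, w i = Real.exp (-(A ∩ t).card) := by
        rw [hw, Finset.prod_ite, Finset.prod_const, Finset.prod_const_one, mul_one,
          ← Real.exp_nat_mul, Finset.filter_mem_eq_inter, Finset.inter_comm]
        ring_nf
      rw [Finset.prod_mul_distrib, hprod, Finset.prod_const, Finset.prod_const]
      have h0 : (0 : ℝ) ≤ (p : ℝ) ^ t.card * (1 - p) ^ (u \ t).card := by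
        have : (0 : ℝ) ≤ 1 - p := by linarith
        positivity
      have hexp : 1 ≤ Real.exp a * Real.exp (-(A ∩ t).card) := by
        rw [← Real.exp_add]
        exact Real.one_le_exp (by linarith)
      nlinarith
    · have : (0 : ℝ) ≤ 1 - p := by linarith
      have hwp : ∀ i, 0 ≤ w i := fun i => by simp only [hw]; split_ifs <;> positivity
      exact mul_nonneg (Real.exp_nonneg _) (mul_nonneg
        (Finset.prod_nonneg fun i _ => mul_nonneg hp0 (hwp i)) (Finset.prod_nonneg fun _ _ => this))
  refine (h1.trans h2).trans ?_
  rw [← Finset.mul_sum, ← Finset.prod_add, sub_eq_add_neg a, Real.exp_add]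
  gcongr
  -- Each factor from `A` is then at most `1 - p / 2 ≤ exp (-p / 2)`.
  have hinv : Real.exp (-1) ≤ 1 / 2 := by
    rw [Real.exp_neg, inv_eq_one_div]
    exact one_div_le_one_div_of_le two_pos (by have := Real.add_one_le_exp (1 : ℝ); linarith)
  calc ∏ i ∈ u, (p * w i + (1 - (p : ℝ)))
      ≤ ∏ i ∈ u, (if i ∈ A then Real.exp (-(p / 2)) else 1) := by
        refine Finset.prod_le_prod (fun i _ => ?_) fun i _ => ?_
        · have : 0 ≤ w i := by simp only [hw]; split_ifs <;> positivity
          have := mul_nonneg hp0 this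
          linarith
        · simp only [hw]
          split_ifs
          · have := Real.add_one_le_exp (-((p : ℝ) / 2))
            nlinarith
          · linarith
    _ = Real.exp (-(p * A.card / 2)) := by
        rw [Finset.prod_ite, Finset.prod_const, Finset.prod_const_one, mul_one,
          ← Real.exp_nat_mul, Finset.filter_mem_eq_inter, Finset.inter_eq_right.2 hA]
        ring_nf

/-- A sum over a family injected into the nonempty subsets of a set of size `M`, each term being
exponentially small in the size of the image. -/
theorem sum_exp_le_of_injOn {κ ι : Type*} [Fintype ι] (F : Finset κ)
    (f : κ → Finset ι) (hf : Set.InjOn f F) (hne : ∀ S ∈ F, (f S).Nonempty) (g : κ → ℝ)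
    (M : ℝ) (hM : Fintype.card ι ≤ M) (hM1 : 1 ≤ M)
    (hg : ∀ S ∈ F, g S ≤ -(2 * (f S).card * Real.log M)) :
    ∑ S ∈ F, Real.exp (g S) ≤ Real.exp 1 / M := by
  classical
  have hM0 : 0 < M := by linarith
  have hlog := Real.log_nonneg hM1
  -- The factor 2 in `hg` gives `M⁻¹` twice per element: one copy makes the sum over all subsets at
  -- most `e`, and nonemptiness of the image leaves a spare `M⁻¹`.
  have hterm : ∀ S ∈ F, Real.exp (g S) ≤ M⁻¹ * ∏ _i ∈ f S, M⁻¹ := by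
    intro S hS
    have hc : (1 : ℝ) ≤ (f S).card := by exact_mod_cast (hne S hS).card_pos
    have : M⁻¹ = Real.exp (-Real.log M) := by rw [Real.exp_neg, Real.exp_log hM0]
    rw [Finset.prod_const, this, ← Real.exp_nat_mul, ← Real.exp_add]
    refine Real.exp_le_exp.2 ((hg S hS).trans ?_)
    nlinarith
  calc ∑ S ∈ F, Real.exp (g S) ≤ ∑ S ∈ F, M⁻¹ * ∏ _i ∈ f S, M⁻¹ := Finset.sum_le_sum hterm
    _ = ∑ T ∈ F.image f, M⁻¹ * ∏ _i ∈ T, M⁻¹ := by rw [Finset.sum_image hf]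
    _ ≤ ∑ T ∈ (Finset.univ : Finset ι).powerset, M⁻¹ * ∏ _i ∈ T, M⁻¹ :=
        Finset.sum_le_sum_of_subset_of_nonneg (fun T _ => by simp) fun T _ _ => by positivity
    _ = M⁻¹ * (1 + M⁻¹) ^ Fintype.card ι := by
        rw [← Finset.mul_sum, ← Finset.prod_one_add, Finset.prod_const, Finset.card_univ]
    _ ≤ M⁻¹ * Real.exp 1 := by
        gcongr
        calc (1 + M⁻¹) ^ Fintype.card ι ≤ Real.exp M⁻¹ ^ Fintype.card ι := by
              gcongr
              linarith [Real.add_one_le_exp M⁻¹]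
          _ = Real.exp (Fintype.card ι * M⁻¹) := by rw [Real.exp_nat_mul]
          _ ≤ Real.exp 1 := by
              refine Real.exp_le_exp.2 ?_
              rw [← div_eq_mul_inv]
              exact (div_le_one hM0).2 hM
    _ = Real.exp 1 / M := by rw [div_eq_inv_mul]

/-! ### Edge boundaries -/

open scoped Classical in
/-- The ordered pairs of adjacent vertices `(u, v)` with `u ∈ S` and `v ∉ S`. -/
noncomputable def edgeBoundary {V : Type*} [Fintype V] (G : SimpleGraph V) (S : Finset V) :
    Finset (V × V) :=
  {e | e.1 ∈ S ∧ e.2 ∉ S ∧ G.Adj e.1 e.2}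

theorem mem_edgeBoundary {V : Type*} [Fintype V] {G : SimpleGraph V} {S : Finset V} {e : V × V} :
    e ∈ edgeBoundary G S ↔ e.1 ∈ S ∧ e.2 ∉ S ∧ G.Adj e.1 e.2 := by
  simp [edgeBoundary]

theorem exists_card_edgeBoundary_lt {V : Type*} [Fintype V] (hV : 2 ≤ Fintype.card V)
    {G : SimpleGraph V} {b : ℝ} (h : edgeIsoperimetricConst G < b) :
    ∃ S : Finset V, S.Nonempty ∧ 2 * S.card ≤ Fintype.card V ∧
      ((edgeBoundary G S).card : ℝ) < b * S.card := by
  classical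
  -- A real infimum over an empty family would be the default value `0`; singletons rule this out.
  have : Nonempty {S : Finset V // S.Nonempty ∧ 2 * S.card ≤ Fintype.card V} := by
    obtain ⟨x⟩ : Nonempty V := Fintype.card_pos_iff.1 (by omega)
    exact ⟨⟨{x}, by simp, by simpa using hV⟩⟩
  obtain ⟨⟨S, hS, hS2⟩, hlt⟩ := exists_lt_of_ciInf_lt h
  have hpos : (0 : ℝ) < S.card := by exact_mod_cast hS.card_pos
  refine ⟨S, hS, hS2, ?_⟩
  rw [div_lt_iff₀ hpos] at hlt
  have : edgeBoundary G S = G.interedges S Sᶜ := by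
    ext e
    rw [mem_edgeBoundary, SimpleGraph.interedges, Rel.mem_interedges_iff, Finset.mem_compl]
  rw [this]
  exact hlt

/-! ### Counting long-range partners -/

theorem card_cycleDist_le {n : ℕ} (a : Fin n) {r : ℕ} (hr : 2 * r + 1 ≤ n) :
    (Finset.univ.filter fun b => cycleDist a b ≤ r).card = 2 * r + 1 := by
  have ha := a.2
  rw [← Finset.card_range (2 * r + 1)]
  symm
  -- The witness is `a + i - r` modulo `n`, written by cases for `omega`; `2 r + 1 ≤ n` keeps the
  -- ball from overlapping itself.
  refine Finset.card_bij (fun i hi => (⟨if a.1 + i < r then a.1 + i + n - r else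
    if a.1 + i - r < n then a.1 + i - r else a.1 + i - r - n, ?_⟩ : Fin n)) ?_ ?_ ?_
  · have := Finset.mem_range.1 hi
    split_ifs <;> omega
  · intro i hi
    have := Finset.mem_range.1 hi
    refine Finset.mem_filter.2 ⟨Finset.mem_univ _, ?_⟩
    simp only [cycleDist, Nat.dist]
    split_ifs <;> omega
  · intro i hi j hj h
    have := Finset.mem_range.1 hi
    have := Finset.mem_range.1 hj
    simp only [Fin.mk.injEq] at h
    split_ifs at h <;> omega
  · intro b hb
    have hb2 := b.2
    replace hb := (Finset.mem_filter.1 hb).2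
    simp only [cycleDist, Nat.dist] at hb
    have key : ∃ i < 2 * r + 1, (if a.1 + i < r then a.1 + i + n - r else
        if a.1 + i - r < n then a.1 + i - r else a.1 + i - r - n) = b.1 := by
      by_cases h1 : a.1 ≤ b.1 + r ∧ b.1 ≤ a.1 + r
      · refine ⟨b.1 + r - a.1, by omega, ?_⟩
        split_ifs <;> omega
      · by_cases h2 : a.1 ≤ b.1
        · refine ⟨b.1 + r - a.1 - n, by omega, ?_⟩
          split_ifs <;> omega
        · refine ⟨b.1 + n + r - a.1, by omega, ?_⟩
          split_ifs <;> omega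
    obtain ⟨i, hi, hib⟩ := key
    exact ⟨i, Finset.mem_range.2 hi, Fin.ext hib⟩

theorem card_torusDist_le {d n : ℕ} (u : Vertex d n) {r : ℕ} (hr : 2 * r + 1 ≤ n) :
    (Finset.univ.filter fun v => torusDist u v ≤ r).card = (2 * r + 1) ^ d := by
  have : (Finset.univ.filter fun v => torusDist u v ≤ r) =
      Fintype.piFinset fun i => Finset.univ.filter fun b => cycleDist (u i) b ≤ r := by
    ext v
    simp [torusDist, Finset.sup_le_iff]
  rw [this, Fintype.card_piFinset]
  simp [card_cycleDist_le _ hr]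

-- The annulus contains the difference of two balls; the strict inequality on `c` absorbs the
-- rounding of the radii.
open scoped Classical in
theorem eventually_card_long_ge {d : ℕ} {α β c : ℝ} (hα : 0 < α) (hαβ : α < β) (hβ : β < 1 / 2)
    (hc : c < (2 * β) ^ d - (2 * α) ^ d) :
    ∀ᶠ n : ℕ in atTop, ∀ u : Vertex d n, c * (n : ℝ) ^ d ≤
      (Finset.univ.filter fun v => α * n ≤ torusDist u v ∧ (torusDist u v : ℝ) ≤ β * n).card := by
  have hinv : Tendsto (fun n : ℕ => (n : ℝ)⁻¹) atTop (𝓝 0) := tendsto_inv_atTop_nhds_zero_nat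
  have hlim : Tendsto (fun n : ℕ => (2 * β - (n : ℝ)⁻¹) ^ d - (2 * α + (n : ℝ)⁻¹) ^ d) atTop
      (𝓝 ((2 * β) ^ d - (2 * α) ^ d)) := by
    simpa using ((hinv.const_sub (2 * β)).pow d).sub ((hinv.const_add (2 * α)).pow d)
  -- This makes the outer ball fit in the torus; the next bound makes `2 β n - 1` nonnegative, so
  -- that it can be raised to the power `d`.
  have hbig : ∀ᶠ n : ℕ in atTop, (1 - 2 * β)⁻¹ ≤ (n : ℝ) :=
    tendsto_natCast_atTop_atTop.eventually_ge_atTop _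
  have hbig' : ∀ᶠ n : ℕ in atTop, (2 * β)⁻¹ ≤ (n : ℝ) :=
    tendsto_natCast_atTop_atTop.eventually_ge_atTop _
  filter_upwards [hlim.eventually_const_lt hc, hbig, hbig', eventually_gt_atTop 0]
    with n h1 h2 h3 hn u
  have hn0 : (0 : ℝ) < n := by exact_mod_cast hn
  have h2 : 1 ≤ (1 - 2 * β) * n := (inv_le_iff_one_le_mul₀' (by linarith)).1 h2
  have h3 : 1 ≤ 2 * β * n := (inv_le_iff_one_le_mul₀' (by linarith)).1 h3
  have hβf := Nat.floor_le (show 0 ≤ β * n by nlinarith)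
  have hβf' := Nat.lt_floor_add_one (β * n)
  have hαf := Nat.floor_le (show 0 ≤ α * n by positivity)
  have hmono : α * n ≤ β * n := by gcongr
  have hrβ : 2 * ⌊β * n⌋₊ + 1 ≤ n := by
    have : (2 * ⌊β * n⌋₊ + 1 : ℝ) ≤ n := by linarith
    exact_mod_cast this
  have hrα : 2 * ⌊α * n⌋₊ + 1 ≤ n := by
    have : (2 * ⌊α * n⌋₊ + 1 : ℝ) ≤ n := by linarith
    exact_mod_cast this
  set D := Finset.univ.filter fun v : Vertex d n =>
    α * n ≤ torusDist u v ∧ (torusDist u v : ℝ) ≤ β * n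
  have hcover : (Finset.univ.filter fun v => torusDist u v ≤ ⌊β * n⌋₊) ⊆
      D ∪ (Finset.univ.filter fun v => torusDist u v ≤ ⌊α * n⌋₊) := by
    intro v hv
    simp only [D, Finset.mem_union, Finset.mem_filter, Finset.mem_univ, true_and] at hv ⊢
    rcases le_or_gt (torusDist u v) ⌊α * n⌋₊ with h | h
    · exact Or.inr h
    · exact Or.inl ⟨((Nat.floor_lt (by positivity)).1 h).le,
        (Nat.le_floor_iff (by nlinarith)).1 hv⟩
  have hcard := (Finset.card_le_card hcover).trans (Finset.card_union_le _ _)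
  rw [card_torusDist_le u hrβ, card_torusDist_le u hrα] at hcard
  have hcard' : ((2 * ⌊β * n⌋₊ + 1 : ℝ)) ^ d ≤ D.card + (2 * ⌊α * n⌋₊ + 1 : ℝ) ^ d := by
    exact_mod_cast hcard
  have e1 : (2 * β - (n : ℝ)⁻¹) ^ d * (n : ℝ) ^ d ≤ (2 * ⌊β * n⌋₊ + 1 : ℝ) ^ d := by
    have : (2 * β - (n : ℝ)⁻¹) * n = 2 * β * n - 1 := by field_simp
    rw [← mul_pow, this]
    exact pow_le_pow_left₀ (by linarith) (by linarith) d
  have e2 : (2 * ⌊α * n⌋₊ + 1 : ℝ) ^ d ≤ (2 * α + (n : ℝ)⁻¹) ^ d * (n : ℝ) ^ d := by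
    have : (2 * α + (n : ℝ)⁻¹) * n = 2 * α * n + 1 := by field_simp
    rw [← mul_pow, this]
    exact pow_le_pow_left₀ (by positivity) (by linarith) d
  have := mul_le_mul_of_nonneg_right h1.le (show (0 : ℝ) ≤ (n : ℝ) ^ d by positivity)
  linarith [sub_mul ((2 * β - (n : ℝ)⁻¹) ^ d) ((2 * α + (n : ℝ)⁻¹) ^ d) ((n : ℝ) ^ d)]

/-! ### Connectivity of the torus -/

/-- A property invariant under the edges of the torus is invariant under changing a coordinate. -/
theorem torusGraph_update_of_forall_adj {d n : ℕ} {P : Vertex d n → Prop}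
    (hP : ∀ u v, (torusGraph d n).Adj u v → P u → P v) (u : Vertex d n) (i : Fin d) (x y : Fin n)
    (h : P (Function.update u i x)) : P (Function.update u i y) := by
  have hn : 0 < n := x.pos
  have step : ∀ k (hk : k + 1 < n), (torusGraph d n).Adj (Function.update u i ⟨k, by omega⟩)
      (Function.update u i ⟨k + 1, hk⟩) := fun k hk =>
    ⟨i, by simp only [Function.update_self, cycleDist, Nat.dist]; omega,
      fun j hj => by simp [Function.update_of_ne hj]⟩
  have all : ∀ k (hk : k < n),
      P (Function.update u i ⟨k, hk⟩) ↔ P (Function.update u i ⟨0, hn⟩) := by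
    intro k
    induction k with
    | zero => intro hk; rfl
    | succ k ih =>
      intro hk
      rw [← ih (by omega)]
      exact ⟨hP _ _ (step k hk).symm, hP _ _ (step k hk)⟩
  exact (all y y.2).2 ((all x x.2).1 h)

/-- Connectivity in induction form: `u` is turned into `v` one coordinate at a time. -/
theorem torusGraph_induction {d n : ℕ} {P : Vertex d n → Prop}
    (hP : ∀ u v, (torusGraph d n).Adj u v → P u → P v) {u : Vertex d n} (h : P u)
    (v : Vertex d n) : P v := by
  classical
  have key : ∀ s : Finset (Fin d), P (fun i => if i ∈ s then v i else u i) := by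
    intro s
    induction s using Finset.induction_on with
    | empty => simpa using h
    | insert a s ha ih =>
      have e : (fun i => if i ∈ insert a s then v i else u i) =
          Function.update (fun i => if i ∈ s then v i else u i) a (v a) := by
        ext i
        by_cases hi : i = a
        · subst hi; simp
        · simp [hi]
      rw [e]
      refine torusGraph_update_of_forall_adj hP _ a (if a ∈ s then v a else u a) _ ?_
      rwa [Function.update_eq_self_iff.2 rfl]
  simpa using key Finset.univ

theorem edgeBoundary_torusGraph_nonempty {d n : ℕ} {S : Finset (Vertex d n)} (hS : S.Nonempty)
    (hS2 : 2 * S.card ≤ Fintype.card (Vertex d n)) :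
    (edgeBoundary (torusGraph d n) S).Nonempty := by
  by_contra hne
  rw [Finset.not_nonempty_iff_eq_empty] at hne
  obtain ⟨u, hu⟩ := hS
  have hall := torusGraph_induction (P := fun v => v ∈ S) (fun x y hxy hx => by
    by_contra hy
    have : (x, y) ∈ edgeBoundary (torusGraph d n) S := mem_edgeBoundary.2 ⟨hx, hy, hxy⟩
    simp [hne] at this) hu
  have : S = Finset.univ := Finset.eq_univ_iff_forall.2 hall
  rw [this, Finset.card_univ] at hS2
  have : 0 < Fintype.card (Vertex d n) := Fintype.card_pos_iff.2 ⟨u⟩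
  omega

/-- A vertex set of the torus is determined by its edge boundary, if this is not empty. -/
theorem eq_of_edgeBoundary_torusGraph_eq {d n : ℕ} {S T : Finset (Vertex d n)}
    (hne : (edgeBoundary (torusGraph d n) S).Nonempty)
    (h : edgeBoundary (torusGraph d n) S = edgeBoundary (torusGraph d n) T) : S = T := by
  obtain ⟨e, he⟩ := hne
  have heS := mem_edgeBoundary.1 he
  have heT := mem_edgeBoundary.1 (h ▸ he)
  ext v
  refine torusGraph_induction (P := fun v => v ∈ S ↔ v ∈ T) (fun x y hxy hx => ?_)
    (iff_of_true heS.1 heT.1) v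
  -- Boundary pairs are oriented outwards: `(x, y)` settles the case where `x` lies in both sets,
  -- `(y, x)` the case where it lies in neither.
  have h1 := Finset.ext_iff.1 h (x, y)
  have h2 := Finset.ext_iff.1 h (y, x)
  simp only [mem_edgeBoundary, hxy, hxy.symm, and_true] at h1 h2
  tauto

/-! ### Long pairs across a cut -/

open scoped Classical in
/-- The pairs that may carry a long edge and join `S` to its complement. -/
noncomputable def longBoundary {d n : ℕ} (α β : ℝ) (S : Finset (Vertex d n)) :
    Finset (Sym2 (Vertex d n)) :=
  (S.sigma fun u => Finset.univ.filter fun v => v ∉ S ∧ α * n ≤ torusDist u v ∧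
    (torusDist u v : ℝ) ≤ β * n).image fun e => s(e.1, e.2)

theorem longBoundary_subset {d n : ℕ} (α β : ℝ) (S : Finset (Vertex d n)) :
    (longBoundary α β S : Set (Sym2 (Vertex d n))) ⊆ longPairs d n α β := by
  classical
  intro e he
  simp only [longBoundary, Finset.coe_image, Set.mem_image, Finset.mem_coe, Finset.mem_sigma,
    Finset.mem_filter, Finset.mem_univ, true_and] at he
  obtain ⟨⟨u, v⟩, ⟨-, -, h1, h2⟩, rfl⟩ := he
  exact ⟨u, v, rfl, h1, h2⟩

theorem ncard_longBoundary_inter_le {d n : ℕ} (α β : ℝ) (S : Finset (Vertex d n))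
    (E : Set (Sym2 (Vertex d n))) :
    ((longBoundary α β S : Set (Sym2 (Vertex d n))) ∩ E).ncard ≤
      (edgeBoundary (nwGraph d n E) S).card := by
  classical
  refine le_trans ?_ (Finset.card_image_le (f := fun e : Vertex d n × Vertex d n => s(e.1, e.2)))
  rw [← Set.ncard_coe_finset]
  refine Set.ncard_le_ncard ?_ (Finset.finite_toSet _)
  rintro e ⟨he, heE⟩
  simp only [longBoundary, Finset.coe_image, Set.mem_image, Finset.mem_coe, Finset.mem_sigma,
    Finset.mem_filter, Finset.mem_univ, true_and] at he ⊢
  obtain ⟨⟨u, v⟩, ⟨hu, hv, -, -⟩, rfl⟩ := he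
  have huv : u ≠ v := fun h => hv (h ▸ hu)
  exact ⟨(u, v), mem_edgeBoundary.2 ⟨hu, hv, Or.inr
    ((SimpleGraph.fromEdgeSet_adj _).2 ⟨heE, huv⟩)⟩, rfl⟩

theorem card_edgeBoundary_torusGraph_le {d n : ℕ} (S : Finset (Vertex d n))
    (E : Set (Sym2 (Vertex d n))) :
    (edgeBoundary (torusGraph d n) S).card ≤ (edgeBoundary (nwGraph d n E) S).card := by
  refine Finset.card_le_card fun e he => ?_
  obtain ⟨h1, h2, h3⟩ := mem_edgeBoundary.1 he
  exact mem_edgeBoundary.2 ⟨h1, h2, Or.inl h3⟩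

-- At most `|S| ≤ n^d / 2` partners of a vertex lie in `S`, leaving `c n^d` outside. No pair is
-- counted twice, as only one endpoint lies in `S`.
open scoped Classical in
theorem card_longBoundary_ge {d n : ℕ} {α β c : ℝ}
    (hlong : ∀ u : Vertex d n, (1 / 2 + c) * (n : ℝ) ^ d ≤
      (Finset.univ.filter fun v => α * n ≤ torusDist u v ∧ (torusDist u v : ℝ) ≤ β * n).card)
    {S : Finset (Vertex d n)} (hS2 : 2 * S.card ≤ Fintype.card (Vertex d n)) :
    c * (n : ℝ) ^ d * S.card ≤ (longBoundary α β S).card := by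
  rw [longBoundary, Finset.card_image_of_injOn, Finset.card_sigma]
  · push_cast
    rw [mul_comm, ← nsmul_eq_mul]
    refine Finset.card_nsmul_le_sum _ _ _ fun u hu => ?_
    have h1 := hlong u
    have hS2' : (2 * S.card : ℝ) ≤ (n : ℝ) ^ d := by
      have : Fintype.card (Vertex d n) = n ^ d := by simp
      rw [this] at hS2
      exact_mod_cast hS2
    have hsub : (Finset.univ.filter fun v => α * n ≤ torusDist u v ∧
        (torusDist u v : ℝ) ≤ β * n) ⊆ (Finset.univ.filter fun v => v ∉ S ∧
          α * n ≤ torusDist u v ∧ (torusDist u v : ℝ) ≤ β * n) ∪ S := by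
      intro v hv
      rw [Finset.mem_filter] at hv
      by_cases hvS : v ∈ S
      · exact Finset.mem_union_right _ hvS
      · exact Finset.mem_union_left _ (Finset.mem_filter.2 ⟨hv.1, hvS, hv.2⟩)
    have h2 : ((Finset.univ.filter fun v => α * n ≤ torusDist u v ∧
        (torusDist u v : ℝ) ≤ β * n).card : ℝ) ≤ (Finset.univ.filter fun v => v ∉ S ∧
          α * n ≤ torusDist u v ∧ (torusDist u v : ℝ) ≤ β * n).card + S.card := by
      exact_mod_cast (Finset.card_le_card hsub).trans (Finset.card_union_le _ _)
    linarith
  · rintro ⟨u, v⟩ huv ⟨u', v'⟩ huv' h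
    simp only [Finset.coe_sigma, Set.mem_sigma_iff, Finset.mem_coe, Finset.mem_filter] at huv huv'
    rcases Sym2.eq_iff.1 h with ⟨rfl, rfl⟩ | ⟨rfl, rfl⟩
    · rfl
    · exact absurd huv.1 huv'.2.2.1

/-! ### Union bound over thin sets -/

open scoped Classical in
/-- The vertex sets with at most half of the vertices whose edge boundary in the torus has fewer
than `b |S|` edges. -/
noncomputable def thinSets (d n : ℕ) (b : ℝ) : Finset (Finset (Vertex d n)) :=
  {S | S.Nonempty ∧ 2 * S.card ≤ Fintype.card (Vertex d n) ∧
    ((edgeBoundary (torusGraph d n) S).card : ℝ) < b * S.card}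

theorem mem_thinSets {d n : ℕ} {b : ℝ} {S : Finset (Vertex d n)} : S ∈ thinSets d n b ↔
    S.Nonempty ∧ 2 * S.card ≤ Fintype.card (Vertex d n) ∧
      ((edgeBoundary (torusGraph d n) S).card : ℝ) < b * S.card := by
  simp [thinSets]

-- A bad cut has few torus edges and few long edges: the former restricts the union bound to thin
-- sets, the latter bounds each term.
open scoped Classical in
theorem longEdgeLaw_real_isoperimetric_lt_le {d n : ℕ} {α β σ ζ c b : ℝ}
    (hV : 2 ≤ Fintype.card (Vertex d n))
    (hlong : ∀ u : Vertex d n, (1 / 2 + c) * (n : ℝ) ^ d ≤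
      (Finset.univ.filter fun v => α * n ≤ torusDist u v ∧ (torusDist u v : ℝ) ≤ β * n).card) :
    (longEdgeLaw d n α β σ ζ).real {E | edgeIsoperimetricConst (nwGraph d n E) < b} ≤
      ∑ S ∈ thinSets d n b,
        Real.exp (-((c * (longEdgeProb d n σ ζ * (n : ℝ) ^ d) / 2 - b) * S.card)) := by
  have hsub : {E | edgeIsoperimetricConst (nwGraph d n E) < b} ⊆ ⋃ S ∈ thinSets d n b,
      {E : Set (Sym2 (Vertex d n)) |
        (((longBoundary α β S : Set (Sym2 (Vertex d n))) ∩ E).ncard : ℝ) ≤ b * S.card} := by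
    intro E hE
    obtain ⟨S, hS, hS2, hlt⟩ := exists_card_edgeBoundary_lt hV hE
    simp only [Set.mem_iUnion]
    refine ⟨S, mem_thinSets.2 ⟨hS, hS2, lt_of_le_of_lt ?_ hlt⟩, le_trans ?_ hlt.le⟩
    · exact_mod_cast card_edgeBoundary_torusGraph_le S E
    · exact_mod_cast ncard_longBoundary_inter_le α β S E
  have : MeasureTheory.IsProbabilityMeasure (longEdgeLaw d n α β σ ζ) := by
    unfold longEdgeLaw; infer_instance
  refine (MeasureTheory.measureReal_mono hsub (MeasureTheory.measure_ne_top _ _)).trans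
    ((MeasureTheory.measureReal_biUnion_finset_le _ _).trans (Finset.sum_le_sum fun S hS => ?_))
  have hS := mem_thinSets.1 hS
  have hsubset : longBoundary α β S ⊆ (longPairs d n α β).toFinset := by
    intro e he
    exact Set.mem_toFinset.2 (longBoundary_subset α β S he)
  have htail := setBernoulli_real_card_filter_le hsubset (longEdgeProb d n σ ζ) (b * S.card)
  rw [Set.coe_toFinset] at htail
  refine htail.trans (Real.exp_le_exp.2 ?_)
  have := mul_le_mul_of_nonneg_left (card_longBoundary_ge hlong hS.2.1)
    (longEdgeProb d n σ ζ).2.1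
  linarith

/-- Clipping at `1` replaces `σ (ln n)^ζ` by its minimum with `n^d`, hence the two upper bounds on
`q`. -/
theorem le_longEdgeProb_mul {d n : ℕ} {σ ζ q : ℝ} (hn : 0 < n) (hq : q ≤ (n : ℝ) ^ d)
    (hqσ : q ≤ σ * Real.log n ^ ζ) : q ≤ longEdgeProb d n σ ζ * (n : ℝ) ^ d := by
  have hN : (0 : ℝ) < (n : ℝ) ^ d := by positivity
  have h1 : q * ((n : ℝ) ^ d)⁻¹ ≤ longEdgeProb d n σ ζ := by
    rw [longEdgeProb, Set.coe_projIcc]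
    refine le_max_of_le_right (le_min ?_ ?_)
    · rw [← div_eq_mul_inv]
      exact (div_le_one hN).2 hq
    · rw [mul_right_comm]
      gcongr
  calc q = q * ((n : ℝ) ^ d)⁻¹ * (n : ℝ) ^ d := by field_simp
    _ ≤ _ := by gcongr

open scoped Classical in
/-- It suffices to bound the expected number of sparse cuts, set by set. -/
theorem whpIsoperimetricGe_of_eventually_injOn {d : ℕ} (hd : 1 ≤ d) {α β σ ζ c : ℝ} (hα : 0 < α)
    (hαβ : α < β) (hβ : β < 1 / 2) (hc : 1 / 2 + c < (2 * β) ^ d - (2 * α) ^ d) {b : ℕ → ℝ}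
    (h : ∀ᶠ n : ℕ in atTop, ∃ (ι : Type) (_ : Fintype ι) (f : Finset (Vertex d n) → Finset ι),
      n ≤ Fintype.card ι ∧ Set.InjOn f (thinSets d n (b n)) ∧ ∀ S ∈ thinSets d n (b n),
        (f S).Nonempty ∧ 2 * (f S).card * Real.log (Fintype.card ι) ≤
          (c * (longEdgeProb d n σ ζ * (n : ℝ) ^ d) / 2 - b n) * S.card) :
    WhpIsoperimetricGe d α β σ ζ b := by
  have hprob : ∀ n, MeasureTheory.IsProbabilityMeasure (longEdgeLaw d n α β σ ζ) := fun n => by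
    unfold longEdgeLaw; infer_instance
  have hbad : ∀ᶠ n : ℕ in atTop, (longEdgeLaw d n α β σ ζ).real
      {E | edgeIsoperimetricConst (nwGraph d n E) < b n} ≤ Real.exp 1 / n := by
    filter_upwards [h, eventually_card_long_ge hα hαβ hβ hc, eventually_ge_atTop 2]
      with n ⟨ι, _, f, hcard, hinj, hf⟩ hlong hn
    have hn' : (2 : ℝ) ≤ n := by exact_mod_cast hn
    have hcard' : (n : ℝ) ≤ Fintype.card ι := by exact_mod_cast hcard
    have hV : 2 ≤ Fintype.card (Vertex d n) := by
      have : Fintype.card (Vertex d n) = n ^ d := by simp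
      rw [this]
      exact hn.trans (Nat.le_self_pow (by omega) n)
    refine (longEdgeLaw_real_isoperimetric_lt_le hV hlong).trans ?_
    refine (sum_exp_le_of_injOn _ f hinj (fun S hS => (hf S hS).1) _ (Fintype.card ι) le_rfl
      (by linarith) fun S hS => neg_le_neg (hf S hS).2).trans ?_
    gcongr
  have hlim : Tendsto (fun n : ℕ => ENNReal.ofReal (1 - Real.exp 1 / n)) atTop (𝓝 1) := by
    have h0 : Tendsto (fun n : ℕ => 1 - Real.exp 1 / (n : ℝ)) atTop (𝓝 1) := by
      simpa using (tendsto_const_div_atTop_nhds_zero_nat (Real.exp 1)).const_sub 1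
    simpa using ENNReal.tendsto_ofReal h0
  refine tendsto_of_tendsto_of_tendsto_of_le_of_le' hlim tendsto_const_nhds ?_
    (Eventually.of_forall fun n => MeasureTheory.prob_le_one)
  filter_upwards [hbad] with n hn
  rw [← MeasureTheory.ofReal_measureReal]
  refine ENNReal.ofReal_le_ofReal ?_
  have hcompl : {E | edgeIsoperimetricConst (nwGraph d n E) < b n} =
      {E | b n ≤ edgeIsoperimetricConst (nwGraph d n E)}ᶜ := by
    ext E; simp
  have hun := MeasureTheory.measureReal_union_le (μ := longEdgeLaw d n α β σ ζ)
    {E | b n ≤ edgeIsoperimetricConst (nwGraph d n E)}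
    {E | b n ≤ edgeIsoperimetricConst (nwGraph d n E)}ᶜ
  rw [Set.union_compl_self, MeasureTheory.probReal_univ, ← hcompl] at hun
  linarith

/-! ### The two regimes -/

theorem tendsto_log_natCast_atTop : Tendsto (fun n : ℕ => Real.log n) atTop atTop :=
  Real.tendsto_log_atTop.comp tendsto_natCast_atTop_atTop

/-- Thin sets are encoded by their torus edge boundary, so any `σ > 0` suffices, even at `ζ = 0`. -/
theorem whpIsoperimetricGe_inv_log {d : ℕ} (hd : 1 ≤ d) {α β σ ζ : ℝ} (hα : 0 < α)
    (hαβ : α < β) (hβ : β < 1 / 2) (hΓ : 1 / 2 < (2 * β) ^ d - (2 * α) ^ d) (hσ : 0 < σ)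
    (hζ : 0 ≤ ζ) :
    ∃ C : ℝ, 0 < C ∧ WhpIsoperimetricGe d α β σ ζ (fun n => C * (Real.log n)⁻¹) := by
  obtain ⟨c', hc1, hc2⟩ := exists_between hΓ
  obtain ⟨c, rfl⟩ : ∃ c, c' = 1 / 2 + c := ⟨c' - 1 / 2, by ring⟩
  have hc : 0 < c := by linarith
  have hd' : (1 : ℝ) ≤ d := by exact_mod_cast hd
  -- The Chernoff rate is at least `c σ / 2 = 2 κ`: one `κ` covers `b`, the other the encoding cost
  -- `4 d ln n` per boundary edge, whence `C = κ / (4 d)`.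
  set κ := c * σ / 4 with hκ
  have hκ0 : 0 < κ := by positivity
  have hC : κ / (4 * d) ≤ κ := div_le_self hκ0.le (by linarith)
  refine ⟨κ / (4 * d), by positivity,
    whpIsoperimetricGe_of_eventually_injOn hd hα hαβ hβ hc2 ?_⟩
  filter_upwards [eventually_ge_atTop 1, tendsto_log_natCast_atTop.eventually_ge_atTop 1,
    tendsto_natCast_atTop_atTop.eventually_ge_atTop σ] with n hn hlog hnσ
  have hn1 : (1 : ℝ) ≤ n := by exact_mod_cast hn
  have hq : σ ≤ longEdgeProb d n σ ζ * (n : ℝ) ^ d := by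
    refine le_longEdgeProb_mul hn (hnσ.trans (le_self_pow₀ hn1 (by omega))) ?_
    exact le_mul_of_one_le_right hσ.le (Real.one_le_rpow hlog hζ)
  have hcard : Fintype.card (Vertex d n × Vertex d n) = n ^ (2 * d) := by
    simp [two_mul, pow_add]
  have hne : ∀ S ∈ thinSets d n (κ / (4 * d) * (Real.log n)⁻¹),
      (edgeBoundary (torusGraph d n) S).Nonempty := fun S hS =>
    edgeBoundary_torusGraph_nonempty (mem_thinSets.1 hS).1 (mem_thinSets.1 hS).2.1
  refine ⟨Vertex d n × Vertex d n, inferInstance, edgeBoundary (torusGraph d n), ?_,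
    fun S hS T _ hST => eq_of_edgeBoundary_torusGraph_eq (hne S hS) hST,
    fun S hS => ⟨hne S hS, ?_⟩⟩
  · rw [hcard]
    exact Nat.le_self_pow (by omega) n
  · have hlt := (mem_thinSets.1 hS).2.2
    have hlog0 : 0 < Real.log n := by linarith
    have hb : κ / (4 * d) * (Real.log n)⁻¹ ≤ κ :=
      (mul_le_of_le_one_right (by positivity) (inv_le_one_of_one_le₀ hlog)).trans hC
    have hmul := mul_le_mul_of_nonneg_left hlt.le
      (show 0 ≤ 4 * (d : ℝ) * Real.log n by positivity)
    have e : 4 * (d : ℝ) * Real.log n * (κ / (4 * d) * (Real.log n)⁻¹ * S.card) =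
        κ * S.card := by field_simp
    rw [e] at hmul
    rw [hcard, Nat.cast_pow, Real.log_pow, Nat.cast_mul, Nat.cast_ofNat]
    have hcq := mul_le_mul_of_nonneg_left hq hc.le
    have : κ * (S.card : ℝ) ≤ (c * (longEdgeProb d n σ ζ * (n : ℝ) ^ d) / 2 -
        κ / (4 * d) * (Real.log n)⁻¹) * S.card := by
      gcongr
      linarith
    linarith

/-- Sets are encoded by themselves. The constant 6 gives rate `3 d ln n`: `2 d ln n` for the
encoding, and `d ln n ≥ 1` for `b = 1`. -/
theorem whpIsoperimetricGe_one {d : ℕ} (hd : 1 ≤ d) {α β σ ζ c : ℝ} (hα : 0 < α)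
    (hαβ : α < β) (hβ : β < 1 / 2) (hc : 0 < c) (hΓ : 1 / 2 + c < (2 * β) ^ d - (2 * α) ^ d)
    (h : ∀ᶠ n : ℕ in atTop, 6 * d / c * Real.log n ≤ σ * Real.log n ^ ζ) :
    WhpIsoperimetricGe d α β σ ζ (fun _ => 1) := by
  have hd' : (1 : ℝ) ≤ d := by exact_mod_cast hd
  refine whpIsoperimetricGe_of_eventually_injOn hd hα hαβ hβ hΓ ?_
  have hlogle : ∀ᶠ n : ℕ in atTop, 6 * d / c * Real.log n ≤ (n : ℝ) := by
    have := (Real.isLittleO_log_id_atTop.comp_tendsto tendsto_natCast_atTop_atTop).def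
      (show 0 < (6 * d / c)⁻¹ by positivity)
    filter_upwards [this] with n hn
    simp only [Function.comp_apply, id_eq, Real.norm_eq_abs, Nat.abs_cast] at hn
    rw [← le_inv_mul_iff₀ (by positivity)]
    exact (le_abs_self _).trans hn
  filter_upwards [h, hlogle, eventually_ge_atTop 1,
    tendsto_log_natCast_atTop.eventually_ge_atTop 1] with n hσ hle hn hlog
  have hn1 : (1 : ℝ) ≤ n := by exact_mod_cast hn
  have hq := le_longEdgeProb_mul hn (hle.trans (le_self_pow₀ hn1 (by omega : d ≠ 0))) hσ
  have hcard : Fintype.card (Vertex d n) = n ^ d := by simp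
  refine ⟨Vertex d n, inferInstance, id, ?_, Function.injective_id.injOn,
    fun S hS => ⟨(mem_thinSets.1 hS).1, ?_⟩⟩
  · rw [hcard]
    exact Nat.le_self_pow (by omega) n
  · rw [hcard, Nat.cast_pow, Real.log_pow, id, mul_right_comm]
    gcongr
    have hcq := mul_le_mul_of_nonneg_left hq hc.le
    have e : c * (6 * d / c * Real.log n) = 6 * (d * Real.log n) := by field_simp
    rw [e] at hcq
    have : 1 ≤ d * Real.log n := one_le_mul_of_one_le_of_one_le hd' hlog
    linarith

end ModifiedNW

theorem proposition2p10 (d : ℕ) (hd : 1 ≤ d) (α β : ℝ) (hα : 0 < α) (hαβ : α < β)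
    (hβ : β < 1 / 2) (hΓ : 1 / 2 < (2 * β) ^ d - (2 * α) ^ d) :
    ((∀ ζ : ℝ, 0 < ζ → ζ < 1 → ∀ σ : ℝ, 0 < σ → ∃ C : ℝ, 0 < C ∧
        ModifiedNW.WhpIsoperimetricGe d α β σ ζ (fun n => C * (Real.log n)⁻¹)) ∧
      (∃ σ₀ : ℝ, 0 < σ₀ ∧ ∀ σ : ℝ, σ₀ ≤ σ → ∃ C : ℝ, 0 < C ∧
        ModifiedNW.WhpIsoperimetricGe d α β σ 0 (fun n => C * (Real.log n)⁻¹))) ∧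
    ((∀ ζ : ℝ, 1 < ζ → ∀ σ : ℝ, 0 < σ → ∃ C : ℝ, 0 < C ∧
        ModifiedNW.WhpIsoperimetricGe d α β σ ζ (fun _ => C)) ∧
      (∃ σ₀ : ℝ, 0 < σ₀ ∧ ∀ σ : ℝ, σ₀ ≤ σ → ∃ C : ℝ, 0 < C ∧
        ModifiedNW.WhpIsoperimetricGe d α β σ 1 (fun _ => C))) := by
  refine ⟨⟨fun ζ hζ _ σ hσ => ModifiedNW.whpIsoperimetricGe_inv_log hd hα hαβ hβ hΓ hσ hζ.le,
    1, one_pos, fun σ hσ => ModifiedNW.whpIsoperimetricGe_inv_log hd hα hαβ hβ hΓ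
      (one_pos.trans_le hσ) le_rfl⟩, ?_⟩
  obtain ⟨c', hc1, hc2⟩ := exists_between hΓ
  obtain ⟨c, rfl⟩ : ∃ c, c' = 1 / 2 + c := ⟨c' - 1 / 2, by ring⟩
  have hc : 0 < c := by linarith
  have hd' : (1 : ℝ) ≤ d := by exact_mod_cast hd
  refine ⟨fun ζ hζ σ hσ => ⟨1, one_pos,
    ModifiedNW.whpIsoperimetricGe_one hd hα hαβ hβ hc hc2 ?_⟩,
    6 * d / c, by positivity, fun σ hσ => ⟨1, one_pos,
    ModifiedNW.whpIsoperimetricGe_one hd hα hαβ hβ hc hc2 ?_⟩⟩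
  -- For `ζ > 1`, `(ln n)^(ζ - 1)` tends to infinity and outgrows any constant divided by `σ`.
  · have hpow := (tendsto_rpow_atTop (sub_pos.2 hζ)).comp ModifiedNW.tendsto_log_natCast_atTop
    filter_upwards [hpow.eventually_ge_atTop (6 * d / c / σ),
      ModifiedNW.tendsto_log_natCast_atTop.eventually_gt_atTop 0] with n hn hlog
    rw [Function.comp_apply, Real.rpow_sub_one hlog.ne', div_le_div_iff₀ hσ hlog] at hn
    linarith
  · filter_upwards [ModifiedNW.tendsto_log_natCast_atTop.eventually_gt_atTop 0] with n hlog
    rw [Real.rpow_one]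
    gcongr
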